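/- \textbf{Model.} There are $N$ items and $K\ge 1$ classes of consumers. Class $k$ has arrival rate $\lambda_k>0$ and weight $w_k=\lambda_k/\sum_l\lambda_l$. Item $i$ has appeal $a_{i,k}>0$ and quality $q_{i,k}\in[0,1]$ for class $k$; the positions have visibilities $v_1\ge\dots\ge v_N\ge 0$, not all zero; $z\ge 0$. Consumers $t=0,1,2,\dots$ arrive one at a time, each belonging to class $k$ with probability $w_k$ independently of the past. A consumer of class $k$ who is shown a ranking $\sigma\in S_N$ (item $i$ in position $\sigma(i)$) and a popularity vector $d\in\mathbb N^N$ tries item $i$ with probability $\frac{v_{\sigma(i)}(a_{i,k}+d_i)}{\sum_j v_{\sigma(j)}(a_{j,k}+d_j)+z}$ (and no item with the remaining probability), and then buys the tried item with probability $q_{i,k}$. There are no purchases before time $0$. Put $\bar q_i=\sum_k w_kq_{i,k}$. An \emph{average quality ranking} is a $\sigma\in S_N$ that lists the items in decreasing order of $\bar q_i$; it is \emph{tie-breaking} if some item $i^*$ satisfies $\bar q_{i^*}v_{\sigma(i^*)}>\bar q_iv_{\sigma(i)}$ for all $i\ne i^*$. A \emph{segmented quality ranking} consists of permutations $\tau_k$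 ($k\in[K]$), where $\tau_k$ lists the items in decreasing order of $q_{i,k}$; it is \emph{tie-breaking} if for each $k$ some item $i_k^*$ satisfies $q_{i_k^*,k}>q_{j,k}$ for all $j\ne i_k^*$. Ties in the orders may be resolved arbitrarily. Let $P^t_{AQGSI}$ be the probability that consumer $t$ makes a purchase when every consumer is shown an average quality ranking $\sigma$ and the vector of all past purchases, and $P^t_{SQSSI}$ the probability that consumer $t$ makes a purchase when every consumer of class $k$ is shown $\tau_k$ and the vector of past purchases by class $k$ only. \textbf{Proposition.} The upper bound $K$ in the bound $1\le\lim_{t\to\infty}P^t_{SQSSI}/P^t_{AQGSI}\le K$ for models whose average and segmented quality rankings are tie-breaking is tight. Precisely, let $K\ge1$. (1) Let $N=K$, let $\lambda_k>0$ be any rates, and number the classes so that $w_1=\min_jw_j$. Let $a_{i,k}>0$ be any appeals, $v_1\ge\dots\ge v_K\ge0$ any visibilities that are not all zero, and $z\ge 0$. For $\varepsilon>0$ with $\varepsilon<\min_jw_j/w_k$ for all $k\neq 1$, let $$q_{i,k}=\begin{cases}\dfrac{\min_jw_j}{w_1}&\text{if }i=k=1,\\[2mm] \dfrac{\min_jw_j}{w_k}-\varepsilon&\text{if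 }i=k\ne1,\\[1mm] 0&\text{otherwise.}\end{cases}$$ This defines a valid model. Every average quality ranking and every segmented quality ranking of it is tie-breaking. The limits $P_{SQSSI}(\varepsilon)=\lim_{t\to\infty}P^t_{SQSSI}$ and $P_{AQGSI}(\varepsilon)=\lim_{t\to\infty}P^t_{AQGSI}$ exist and do not depend on the choice of these rankings, $P_{AQGSI}(\varepsilon)>0$, and $\lim_{t\to\infty}P^t_{SQSSI}/P^t_{AQGSI}=P_{SQSSI}(\varepsilon)/P_{AQGSI}(\varepsilon)$. Moreover $$\lim_{\varepsilon\to0^+}\frac{P_{SQSSI}(\varepsilon)}{P_{AQGSI}(\varepsilon)}=K .$$ (2) Consequently, for every real $C<K$ there is a model with $K$ items and $K$ classes, with tie-breaking average and segmented quality rankings, such that $L=\lim_{t\to\infty}P^t_{SQSSI}/P^t_{AQGSI}$ exists and $C<L\le K$. -/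

import Mathlib

open Filter Topology

noncomputable section

/-- The weight of class `k`: its share of the total arrival rate. -/
def classWeight {K : ℕ} (rate : Fin K → ℝ) (k : Fin K) : ℝ :=
  rate k / ∑ l, rate l

/-- A mixed multinomial logit (MMNL) trial-offer market with `N` items and `K` classes of
consumers. Positions are indexed by decreasing visibility. -/
structure MMNL (N K : ℕ) where
  /-- arrival rates of the classes -/
  rate : Fin K → ℝ
  /-- `appeal i k`: appeal of item `i` for class `k` -/
  appeal : Fin N → Fin K → ℝ
  /-- `quality i k`: probability that a consumer of class `k` who tries item `i` buys it -/
  quality : Fin N → Fin K → ℝ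
  /-- `vis j`: visibility of position `j` -/
  vis : Fin N → ℝ
  /-- the no-trial constant -/
  z : ℝ
  classes_pos : 0 < K
  rate_pos : ∀ k, 0 < rate k
  appeal_pos : ∀ i k, 0 < appeal i k
  quality_nonneg : ∀ i k, 0 ≤ quality i k
  quality_le_one : ∀ i k, quality i k ≤ 1
  vis_nonneg : ∀ j, 0 ≤ vis j
  vis_antitone : Antitone vis
  exists_vis_pos : ∃ j, 0 < vis j
  z_nonneg : 0 ≤ z

namespace MMNL

variable {N K : ℕ} (M : MMNL N K)

/-- The weight `w k` of class `k`. -/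
def weight (k : Fin K) : ℝ := classWeight M.rate k

/-- The weighted average quality of item `i`. -/
def avgQuality (i : Fin N) : ℝ := ∑ k, M.weight k * M.quality i k

/-- The probability that a consumer of class `k` tries item `i`, when item `j` is displayed in
position `σ j` and the popularity vector `d` is shown. -/
def tryProb (σ : Equiv.Perm (Fin N)) (d : Fin N → ℕ) (k : Fin K) (i : Fin N) : ℝ :=
  M.vis (σ i) * (M.appeal i k + d i) / (∑ j, M.vis (σ j) * (M.appeal j k + d j) + M.z)

theorem weight_nonneg (k : Fin K) : 0 ≤ M.weight k :=
  div_nonneg (M.rate_pos k).le (Finset.sum_nonneg fun l _ => (M.rate_pos l).le)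

theorem sum_weight : ∑ k, M.weight k = 1 := by
  have : Nonempty (Fin K) := ⟨⟨0, M.classes_pos⟩⟩
  have h : 0 < ∑ l, M.rate l :=
    Finset.sum_pos (fun l _ => M.rate_pos l) Finset.univ_nonempty
  simp only [weight, classWeight]
  rw [← Finset.sum_div, div_self h.ne']

theorem vis_mul_nonneg (σ : Equiv.Perm (Fin N)) (d : Fin N → ℕ) (k : Fin K) (i : Fin N) :
    0 ≤ M.vis (σ i) * (M.appeal i k + d i) :=
  mul_nonneg (M.vis_nonneg _) (add_nonneg (M.appeal_pos i k).le (Nat.cast_nonneg _))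

theorem tryProb_nonneg (σ : Equiv.Perm (Fin N)) (d : Fin N → ℕ) (k : Fin K) (i : Fin N) :
    0 ≤ M.tryProb σ d k i :=
  div_nonneg (M.vis_mul_nonneg σ d k i)
    (add_nonneg (Finset.sum_nonneg fun j _ => M.vis_mul_nonneg σ d k j) M.z_nonneg)

theorem sum_tryProb_le_one (σ : Equiv.Perm (Fin N)) (d : Fin N → ℕ) (k : Fin K) :
    ∑ i, M.tryProb σ d k i ≤ 1 := by
  simp only [tryProb]
  rw [← Finset.sum_div]
  exact div_le_one_of_le₀ (le_add_of_nonneg_right M.z_nonneg)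
    (add_nonneg (Finset.sum_nonneg fun j _ => M.vis_mul_nonneg σ d k j) M.z_nonneg)

/-- The law of the class of the next consumer. -/
def arrivalLaw : PMF (Fin K) :=
  PMF.ofFintype (fun k => ENNReal.ofReal (M.weight k)) (by
    rw [← ENNReal.ofReal_sum_of_nonneg fun k _ => M.weight_nonneg k, M.sum_weight,
      ENNReal.ofReal_one])

/-- The law of the item tried by a consumer of class `k` (`none`: no item is tried). -/
def tryLaw (σ : Equiv.Perm (Fin N)) (d : Fin N → ℕ) (k : Fin K) : PMF (Option (Fin N)) :=
  PMF.ofFintype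
    (fun o => o.elim (ENNReal.ofReal (1 - ∑ i, M.tryProb σ d k i))
      (fun i => ENNReal.ofReal (M.tryProb σ d k i))) (by
    rw [Fintype.sum_option]
    simp only [Option.elim_none, Option.elim_some]
    rw [← ENNReal.ofReal_sum_of_nonneg fun i _ => M.tryProb_nonneg σ d k i,
      ← ENNReal.ofReal_add (sub_nonneg.2 (M.sum_tryProb_le_one σ d k))
        (Finset.sum_nonneg fun i _ => M.tryProb_nonneg σ d k i),
      sub_add_cancel, ENNReal.ofReal_one])

/-- The law of the decision of a consumer of class `k` who has tried item `i`: `true` (purchase)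
with probability `quality i k`. -/
def buyLaw (k : Fin K) (i : Fin N) : PMF Bool :=
  PMF.ofFintype
    (fun b => cond b (ENNReal.ofReal (M.quality i k)) (ENNReal.ofReal (1 - M.quality i k))) (by
    rw [Fintype.sum_bool, cond_true, cond_false,
      ← ENNReal.ofReal_add (M.quality_nonneg i k) (sub_nonneg.2 (M.quality_le_one i k)),
      add_sub_cancel, ENNReal.ofReal_one])

/-- The law of the item purchased by a consumer of class `k` (`none`: no purchase). -/
def purchaseLaw (σ : Equiv.Perm (Fin N)) (d : Fin N → ℕ) (k : Fin K) : PMF (Option (Fin N)) :=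
  (M.tryLaw σ d k).bind fun o => o.elim (PMF.pure none) fun i =>
    (M.buyLaw k i).map fun b => if b then some i else none

/-- The law of the pair (class, purchased item) of the next consumer. Here `D k i` is the number of
past purchases of item `i` by class `k`; a consumer of class `k` sees the ranking `τ k` and the
popularity vector `signal D k`. -/
def consumerLaw (τ : Fin K → Equiv.Perm (Fin N))
    (signal : (Fin K → Fin N → ℕ) → Fin K → Fin N → ℕ) (D : Fin K → Fin N → ℕ) :
    PMF (Fin K × Option (Fin N)) :=
  M.arrivalLaw.bind fun k => (M.purchaseLaw (τ k) (signal D k) k).map fun o => (k, o)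

end MMNL

/-- The purchase counts after a consumer of class `c.1` has purchased `c.2`. -/
def recordPurchase {N K : ℕ} (D : Fin K → Fin N → ℕ) (c : Fin K × Option (Fin N)) :
    Fin K → Fin N → ℕ :=
  fun k i => D k i + if k = c.1 ∧ c.2 = some i then 1 else 0

/-- The global popularity signal: every consumer sees the purchases made by all classes. -/
def globalSignal {N K : ℕ} (D : Fin K → Fin N → ℕ) (_k : Fin K) : Fin N → ℕ :=
  fun i => ∑ l, D l i

/-- The segmented popularity signal: every consumer sees the purchases made by her own class. -/
def classSignal {N K : ℕ} (D : Fin K → Fin N → ℕ) (k : Fin K) : Fin N → ℕ := D k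

namespace MMNL

variable {N K : ℕ} (M : MMNL N K)

/-- The law of the purchase counts seen when consumer `t` arrives (`t = 0, 1, 2, …`): a Markov
chain started without purchases. -/
def countsLaw (τ : Fin K → Equiv.Perm (Fin N))
    (signal : (Fin K → Fin N → ℕ) → Fin K → Fin N → ℕ) : ℕ → PMF (Fin K → Fin N → ℕ)
  | 0 => PMF.pure 0
  | t + 1 => (countsLaw τ signal t).bind fun D =>
      (M.consumerLaw τ signal D).map (recordPurchase D)

/-- The probability that consumer `t` makes a purchase. -/
def purchaseProb (τ : Fin K → Equiv.Perm (Fin N))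
    (signal : (Fin K → Fin N → ℕ) → Fin K → Fin N → ℕ) (t : ℕ) : ℝ :=
  ((((M.countsLaw τ signal t).bind (M.consumerLaw τ signal)).map
    fun c => c.2.isSome) true).toReal

/-- Purchase probability at time `t` with one ranking `σ` for all consumers and the global
popularity signal. -/
def probAQGSI (σ : Equiv.Perm (Fin N)) (t : ℕ) : ℝ :=
  M.purchaseProb (fun _ => σ) globalSignal t

/-- Purchase probability at time `t` with one ranking `τ k` for each class `k` and the segmented
popularity signal. -/
def probSQSSI (τ : Fin K → Equiv.Perm (Fin N)) (t : ℕ) : ℝ :=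
  M.purchaseProb τ classSignal t

/-- `σ` is an average quality ranking (`σ i` is the position of item `i`): it lists the items by
decreasing weighted average quality. -/
def IsAvgQualityRanking (σ : Equiv.Perm (Fin N)) : Prop :=
  ∀ i j, M.avgQuality j < M.avgQuality i → σ i < σ j

/-- `τ` is a segmented quality ranking: `τ k` lists the items by decreasing quality for class
`k`. -/
def IsSegQualityRanking (τ : Fin K → Equiv.Perm (Fin N)) : Prop :=
  ∀ k i j, M.quality j k < M.quality i k → τ k i < τ k j

/-- The static ranking `σ` is tie-breaking. -/
def TieBreaking (σ : Equiv.Perm (Fin N)) : Prop :=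
  ∃ i₀, ∀ i, i ≠ i₀ → M.avgQuality i * M.vis (σ i) < M.avgQuality i₀ * M.vis (σ i₀)

/-- The segmented quality ranking is tie-breaking: each class has a unique best item. -/
def SegTieBreaking : Prop :=
  ∀ k, ∃ i₀, ∀ j, j ≠ i₀ → M.quality j k < M.quality i₀ k

end MMNL

/-- The diagonal qualities of the extremal model: `K` items, `K` classes of weights `w`, and a
distinguished class `k₀`. -/
def diagQuality {K : ℕ} (w : Fin K → ℝ) (k₀ : Fin K) (ε : ℝ) (i k : Fin K) : ℝ :=
  if i = k then (if k = k₀ then (⨅ j, w j) / w k₀ else (⨅ j, w j) / w k - ε) else 0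

end

/-!
Consumers who are shown the same ranking and popularity vector pool their purchases into a
generalized urn. In such an urn the count of the dominant item, the one with the largest product of
quality and visibility, tends to infinity in probability, because its reciprocal decreases in mean
by a proportion of order `1 / size`, and the size of the urn grows only linearly. Once that count is
large, the ratio of the weight of the rivals to it is again a Lyapunov function with a drift of
relative order `-δ / size`, so its mean vanishes as well and the dominant item is eventually tried
with probability tending to one.

Hence the purchase probability tends to the largest average quality when all classes are pooled, and
to the weighted mean of the classes' largest qualities when each class is alone. In the extremal
market with `m = min w`, these limits are `m` and `K m - (1 - m) ε`.
-/

/-- A Markov chain that moves from the state `s` to `step s j` with probability `rate s j`, for `j`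
in a finite set of jumps, and stays at `s` with the remaining probability. -/
structure JumpChain (S J : Type*) [Fintype J] where
  /-- the probability of the jump `j` in the state `s` -/
  rate : S → J → ℝ
  /-- the state reached from `s` by the jump `j` -/
  step : S → J → S
  rate_nonneg : ∀ s j, 0 ≤ rate s j
  sum_rate_le_one : ∀ s, ∑ j, rate s j ≤ 1

namespace JumpChain

section General

variable {S J : Type*} [Fintype J] (X : JumpChain S J)

/-- The transition operator of a jump chain: `(X.transition ^ t) f s` is the mean of `f` at time `t`
when the chain is started at `s`. -/
noncomputable def transition : Module.End ℝ (S → ℝ) where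
  toFun f s := f s + ∑ j, X.rate s j * (f (X.step s j) - f s)
  map_add' f g := by
    ext s
    simp only [Pi.add_apply, add_add_add_comm, ← Finset.sum_add_distrib]
    congr! 2
    ring
  map_smul' c f := by
    ext s
    simp only [Pi.smul_apply, smul_eq_mul, RingHom.id_apply, mul_add, Finset.mul_sum]
    congr! 2
    ring

/-- A set of states that the chain does not leave. -/
def IsAbsorbing (A : Set S) : Prop :=
  ∀ s ∈ A, ∀ j, X.step s j ∈ A

/-- The mean of `f` along the chain started at `s` tends to zero. -/
def VanishesFrom (f : S → ℝ) (s : S) : Prop :=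
  Tendsto (fun t : ℕ => (X.transition ^ t) f s) atTop (𝓝 0)

theorem transition_apply (f : S → ℝ) (s : S) :
    X.transition f s = f s + ∑ j, X.rate s j * (f (X.step s j) - f s) := rfl

theorem transition_apply_eq_convex_combination (f : S → ℝ) (s : S) :
    X.transition f s = (1 - ∑ j, X.rate s j) * f s + ∑ j, X.rate s j * f (X.step s j) := by
  simp only [transition_apply, mul_sub, Finset.sum_sub_distrib, ← Finset.sum_mul]
  ring

theorem transition_pow_succ_apply (t : ℕ) (f : S → ℝ) (s : S) :
    (X.transition ^ (t + 1)) f s = X.transition ((X.transition ^ t) f) s := by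
  rw [pow_succ', Module.End.mul_apply]

theorem transition_pow_const (c : ℝ) (t : ℕ) :
    (X.transition ^ t) (fun _ => c) = fun _ => c := by
  rw [Module.End.pow_apply]
  refine Function.iterate_fixed (funext fun s => ?_) t
  simp [transition_apply]

theorem isAbsorbing_univ : X.IsAbsorbing Set.univ := fun _ _ _ => Set.mem_univ _

variable {X}

theorem transition_apply_le {f g : S → ℝ} {s : S} (h : f s ≤ g s)
    (h_step : ∀ j, f (X.step s j) ≤ g (X.step s j)) : X.transition f s ≤ X.transition g s := by
  simp only [transition_apply_eq_convex_combination]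
  exact add_le_add (mul_le_mul_of_nonneg_left h (sub_nonneg.2 (X.sum_rate_le_one s)))
    (Finset.sum_le_sum fun j _ => mul_le_mul_of_nonneg_left (h_step j) (X.rate_nonneg s j))

theorem IsAbsorbing.transition_pow_apply_le {A : Set S} (hA : X.IsAbsorbing A) {f g : S → ℝ}
    (h : ∀ s ∈ A, f s ≤ g s) (t : ℕ) :
    ∀ s ∈ A, (X.transition ^ t) f s ≤ (X.transition ^ t) g s := by
  induction t with
  | zero => simpa using h
  | succ t ih =>
    intro s hs
    simp only [transition_pow_succ_apply]
    exact transition_apply_le (ih s hs) fun j => ih _ (hA s hs j)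

theorem IsAbsorbing.transition_pow_apply_nonneg {A : Set S} (hA : X.IsAbsorbing A) {f : S → ℝ}
    (h : ∀ s ∈ A, 0 ≤ f s) (t : ℕ) {s : S} (hs : s ∈ A) : 0 ≤ (X.transition ^ t) f s := by
  simpa using hA.transition_pow_apply_le (f := 0) h t s hs

theorem transition_pow_mono {f g : S → ℝ} (h : f ≤ g) (t : ℕ) :
    (X.transition ^ t) f ≤ (X.transition ^ t) g := fun s =>
  X.isAbsorbing_univ.transition_pow_apply_le (fun s _ => h s) t s (Set.mem_univ s)

theorem VanishesFrom.const_mul {f : S → ℝ} {s : S} (h : X.VanishesFrom f s) (c : ℝ) :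
    X.VanishesFrom (fun s => c * f s) s := by
  have h_smul (t : ℕ) : (X.transition ^ t) (fun s => c * f s) s = c * (X.transition ^ t) f s :=
    congrFun (map_smul (X.transition ^ t) c f) s
  simpa only [VanishesFrom, h_smul, mul_zero] using Tendsto.const_mul c h

theorem VanishesFrom.finset_sum {κ : Type*} {u : Finset κ} {f : κ → S → ℝ} {s : S}
    (h : ∀ k ∈ u, X.VanishesFrom (f k) s) : X.VanishesFrom (fun s => ∑ k ∈ u, f k s) s := by
  have h_sum (t : ℕ) : (X.transition ^ t) (fun s => ∑ k ∈ u, f k s) s =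
      ∑ k ∈ u, (X.transition ^ t) (f k) s := by
    rw [← Finset.sum_apply s, ← map_sum, ← Finset.sum_fn]
  simpa only [VanishesFrom, h_sum, Finset.sum_const_zero] using tendsto_finsetSum u h

theorem IsAbsorbing.vanishesFrom_of_le {A : Set S} (hA : X.IsAbsorbing A) {f g : S → ℝ}
    (hf : ∀ s ∈ A, 0 ≤ f s) (hfg : ∀ s ∈ A, f s ≤ g s) {s : S} (hs : s ∈ A)
    (hg : X.VanishesFrom g s) : X.VanishesFrom f s :=
  squeeze_zero (fun t => hA.transition_pow_apply_nonneg hf t hs)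
    (fun t => hA.transition_pow_apply_le hfg t s hs) hg

theorem tendsto_transition_pow_of_abs_sub_le {p h : S → ℝ} {m : ℝ} (hp : ∀ s, |p s - m| ≤ h s)
    {s : S} (hh : X.VanishesFrom h s) :
    Tendsto (fun t : ℕ => (X.transition ^ t) p s) atTop (𝓝 m) := by
  have h_sub (t : ℕ) : (X.transition ^ t) p s - m = (X.transition ^ t) (p - fun _ => m) s := by
    rw [map_sub, Pi.sub_apply, transition_pow_const]
  rw [tendsto_iff_dist_tendsto_zero]
  refine squeeze_zero (fun _ => dist_nonneg) (fun t => ?_) hh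
  rw [Real.dist_eq, h_sub, abs_le, ← Pi.neg_apply, ← map_neg]
  exact ⟨transition_pow_mono (fun s => (abs_le.1 (hp s)).1) t s,
    transition_pow_mono (fun s => (abs_le.1 (hp s)).2) t s⟩

theorem tendsto_transition_pow_of_pointwise {g : ℕ → S → ℝ}
    (hg : ∀ s, Tendsto (fun u => g u s) atTop (𝓝 0)) (t : ℕ) :
    ∀ s, Tendsto (fun u => (X.transition ^ t) (g u) s) atTop (𝓝 0) := by
  induction t with
  | zero => simpa using hg
  | succ t ih =>
    intro s
    simp only [transition_pow_succ_apply, transition_apply]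
    simpa using (ih s).add (tendsto_finsetSum Finset.univ fun j _ =>
      ((ih (X.step s j)).sub (ih s)).const_mul (X.rate s j))

/-- Here `U` dominates the indicator of the complement of `A`, so the hypothesis on `U` says that
the chain is in `A` at time `t` with probability tending to one. -/
theorem vanishesFrom_of_reached {A : Set S} {h U : S → ℝ} (h_nonneg : ∀ s, 0 ≤ h s)
    (h_le_one : ∀ s, h s ≤ 1) (hA : ∀ s ∈ A, X.VanishesFrom h s) (hU : ∀ s, 0 ≤ U s)
    (hU_compl : ∀ s ∉ A, 1 ≤ U s) {s : S} (hU_lim : X.VanishesFrom U s) :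
    X.VanishesFrom h s := by
  classical
  let g (u : ℕ) : S → ℝ := A.indicator ((X.transition ^ u) h)
  have hg (s : S) : Tendsto (fun u => g u s) atTop (𝓝 0) := by
    by_cases hs : s ∈ A
    · simpa only [g, Set.indicator_of_mem hs, VanishesFrom] using hA s hs
    · simp [g, hs]
  have h_split (u : ℕ) : (X.transition ^ u) h ≤ U + g u := fun s => by
    by_cases hs : s ∈ A
    · simpa [g, hs] using hU s
    · have h_one := transition_pow_mono (X := X) (g := fun _ => 1) h_le_one u s
      rw [transition_pow_const] at h_one
      simpa [g, hs] using h_one.trans (hU_compl s hs)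
  refine tendsto_order.2 ⟨fun e he => .of_forall fun t => he.trans_le ?_, fun e he => ?_⟩
  · exact X.isAbsorbing_univ.transition_pow_apply_nonneg (fun s _ => h_nonneg s) t (Set.mem_univ s)
  obtain ⟨T, hT⟩ := (hU_lim.eventually (gt_mem_nhds (half_pos he))).exists
  obtain ⟨u₀, h_tail⟩ := eventually_atTop.1
    ((tendsto_transition_pow_of_pointwise (X := X) hg T s).eventually (gt_mem_nhds (half_pos he)))
  filter_upwards [eventually_ge_atTop (T + u₀)] with t ht
  obtain ⟨u, rfl⟩ := Nat.exists_eq_add_of_le (le_of_add_le_left ht)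
  calc (X.transition ^ (T + u)) h s = (X.transition ^ T) ((X.transition ^ u) h) s := by
        rw [pow_add, Module.End.mul_apply]
    _ ≤ (X.transition ^ T) (U + g u) s := transition_pow_mono (h_split u) T s
    _ = (X.transition ^ T) U s + (X.transition ^ T) (g u) s := by rw [map_add, Pi.add_apply]
    _ < e / 2 + e / 2 := add_lt_add hT (h_tail u (Nat.le_of_add_le_add_left ht))
    _ = e := add_halves e

theorem tendsto_sum_range_one_div_add_mul {x κ : ℝ} (hx : 0 < x) (hκ : 0 ≤ κ) :
    Tendsto (fun t : ℕ => ∑ u ∈ Finset.range t, 1 / (x + κ * u)) atTop atTop := by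
  have hxκ : 0 < x + κ := by positivity
  refine tendsto_atTop_mono (fun t => ?_)
    (Real.tendsto_sum_range_one_div_nat_succ_atTop.const_mul_atTop (inv_pos.2 hxκ))
  rw [Finset.mul_sum]
  refine Finset.sum_le_sum fun u _ => ?_
  rw [inv_mul_eq_div, div_div]
  exact one_div_le_one_div_of_le (by positivity) (by nlinarith [mul_nonneg hx.le u.cast_nonneg])

theorem IsAbsorbing.transition_pow_apply_le_exp_mul {A : Set S} (hA : X.IsAbsorbing A)
    {V size : S → ℝ} {δ κ : ℝ} (hδ : 0 ≤ δ) (hκ : 0 ≤ κ) (hV : ∀ s ∈ A, 0 ≤ V s)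
    (h_size : ∀ s, 0 < size s) (h_step : ∀ s j, size (X.step s j) ≤ size s + κ)
    (h_drift : ∀ s ∈ A, X.transition V s ≤ (1 - δ / size s) * V s) (t : ℕ) :
    ∀ s ∈ A, (X.transition ^ t) V s ≤
      Real.exp (-(δ * ∑ u ∈ Finset.range t, 1 / (size s + κ * u))) * V s := by
  induction t with
  | zero => simp
  | succ t ih =>
    intro s hs
    set E := Real.exp (-(δ * ∑ u ∈ Finset.range t, 1 / (size s + κ * (u + 1)))) with hE
    have h_next : ∀ s' ∈ A, size s' ≤ size s + κ → (X.transition ^ t) V s' ≤ (E • V) s' := by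
      intro s' hs' h_le
      refine (ih s' hs').trans (mul_le_mul_of_nonneg_right ?_ (hV s' hs'))
      have hs'_pos := h_size s'
      exact Real.exp_le_exp.2 (neg_le_neg (mul_le_mul_of_nonneg_left (Finset.sum_le_sum fun u _ =>
        one_div_le_one_div_of_le (by positivity) (by linarith)) hδ))
    calc (X.transition ^ (t + 1)) V s = X.transition ((X.transition ^ t) V) s :=
          X.transition_pow_succ_apply t V s
      _ ≤ X.transition (E • V) s :=
          transition_apply_le (h_next s hs (by linarith)) fun j =>
            h_next _ (hA s hs j) (h_step s j)
      _ = E * X.transition V s := by rw [map_smul, Pi.smul_apply, smul_eq_mul]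
      _ ≤ E * ((1 - δ / size s) * V s) := by gcongr; exact h_drift s hs
      _ ≤ E * (Real.exp (-(δ / size s)) * V s) := by
          gcongr
          · exact hV s hs
          · exact Real.one_sub_le_exp_neg _
      _ = _ := by
          rw [← mul_assoc, hE, ← Real.exp_add, Finset.sum_range_succ']
          congr 2
          push_cast
          ring

/-- The size grows at most linearly in time, so the drift of relative order `1 / size` accumulates
like a harmonic series. -/
theorem IsAbsorbing.vanishesFrom_of_drift {A : Set S} (hA : X.IsAbsorbing A)
    {V size : S → ℝ} {δ κ : ℝ} (hδ : 0 < δ) (hκ : 0 ≤ κ) (hV : ∀ s ∈ A, 0 ≤ V s)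
    (h_size : ∀ s, 0 < size s) (h_step : ∀ s j, size (X.step s j) ≤ size s + κ)
    (h_drift : ∀ s ∈ A, X.transition V s ≤ (1 - δ / size s) * V s) {s : S} (hs : s ∈ A) :
    X.VanishesFrom V s := by
  have h_exp : Tendsto (fun t : ℕ =>
      Real.exp (-(δ * ∑ u ∈ Finset.range t, 1 / (size s + κ * u)))) atTop (𝓝 0) :=
    Real.tendsto_exp_neg_atTop_nhds_zero.comp
      ((tendsto_sum_range_one_div_add_mul (h_size s) hκ).const_mul_atTop hδ)
  refine squeeze_zero (fun t => hA.transition_pow_apply_nonneg hV t hs)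
    (fun t => hA.transition_pow_apply_le_exp_mul hδ.le hκ hV h_size h_step h_drift t s hs) ?_
  simpa using h_exp.mul_const (V s)

theorem transition_pow_comp {S' J' : Type*} [Fintype J'] {Y : JumpChain S' J'} {π : S → S'}
    (h : ∀ f, X.transition (f ∘ π) = Y.transition f ∘ π) (t : ℕ) (f : S' → ℝ) :
    (X.transition ^ t) (f ∘ π) = (Y.transition ^ t) f ∘ π := by
  have h_semiconj : Function.Semiconj (· ∘ π) Y.transition X.transition := fun f => (h f).symm
  simpa only [Module.End.pow_apply] using ((h_semiconj.iterate_right t) f).symm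

end General

section Urn

theorem sum_mul_add_single {ι : Type*} [DecidableEq ι] (v : ι → ℝ) (n : ι → ℕ) (i : ι)
    (s : Finset ι) :
    ∑ j ∈ s, v j * ((n + Pi.single i 1 : ι → ℕ) j : ℝ) =
      ∑ j ∈ s, v j * n j + if i ∈ s then v i else 0 := by
  simp [mul_add, Finset.sum_add_distrib, Pi.single_apply]

variable {ι : Type*} [Fintype ι] [DecidableEq ι] {X : JumpChain (ι → ℕ) ι} {v : ι → ℝ} {i₀ : ι}
  {α b c c' : ℝ}

/-- A generalized urn: the states count the balls of each colour, and the jump `i` adds a ball of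
colour `i`. -/
def IsUrn (X : JumpChain (ι → ℕ) ι) : Prop :=
  ∀ n i, X.step n i = n + Pi.single i 1

theorem IsUrn.isAbsorbing_le (hX : X.IsUrn) (i : ι) (m : ℕ) : X.IsAbsorbing {n | m ≤ n i} :=
  fun n hn j => by
    rw [Set.mem_ofPred_eq, hX, Pi.add_apply]
    exact le_add_right hn

theorem IsUrn.vanishesFrom_of_drift (hX : X.IsUrn) (hv : ∀ i, 0 ≤ v i) (hb : 0 < b)
    {A : Set (ι → ℕ)} (hA : X.IsAbsorbing A) {V : (ι → ℕ) → ℝ} {δ : ℝ} (hδ : 0 < δ)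
    (hV : ∀ n ∈ A, 0 ≤ V n)
    (h_drift : ∀ n ∈ A, X.transition V n ≤ (1 - δ / (∑ i, v i * n i + b)) * V n)
    {n : ι → ℕ} (hn : n ∈ A) : X.VanishesFrom V n := by
  refine hA.vanishesFrom_of_drift hδ (κ := ∑ i, v i) (Finset.sum_nonneg fun i _ => hv i) hV
    (fun n => ?_) (fun n i => ?_) h_drift hn
  · exact add_pos_of_nonneg_of_pos
      (Finset.sum_nonneg fun i _ => mul_nonneg (hv i) (n i).cast_nonneg) hb
  · have h_le := Finset.single_le_sum (fun j _ => hv j) (Finset.mem_univ i)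
    rw [hX, sum_mul_add_single, if_pos (Finset.mem_univ i)]
    linarith

theorem IsUrn.transition_one_div (hX : X.IsUrn) (hα : 0 < α) (n : ι → ℕ) :
    X.transition (fun n => 1 / (α + n i₀)) n =
      (1 - X.rate n i₀ / (α + n i₀ + 1)) * (1 / (α + n i₀)) := by
  rw [transition_apply, Finset.sum_eq_single i₀]
  · simp only [hX n i₀, Pi.add_apply, Pi.single_eq_same]
    push_cast
    field_simp
    ring
  · intro i _ hi
    simp [hX n i, hi.symm]
  · simp

theorem IsUrn.vanishesFrom_one_div (hX : X.IsUrn) (hv : ∀ i, 0 ≤ v i) (hα : 0 < α) (hb : 0 < b)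
    (hc : 0 < c) (h_rate : ∀ n, c * (α + n i₀) / (∑ i, v i * n i + b) ≤ X.rate n i₀)
    (n : ι → ℕ) : X.VanishesFrom (fun n => 1 / (α + n i₀)) n := by
  refine hX.vanishesFrom_of_drift hv hb X.isAbsorbing_univ (δ := c * (α / (α + 1)))
    (by positivity) (fun n _ => by positivity) (fun n _ => ?_) (Set.mem_univ n)
  have h_sum : 0 ≤ ∑ i, v i * (n i : ℝ) :=
    Finset.sum_nonneg fun i _ => mul_nonneg (hv i) (n i).cast_nonneg
  have h_frac : α / (α + 1) ≤ (α + n i₀) / (α + n i₀ + 1) := by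
    rw [div_le_div_iff₀ (by positivity) (by positivity)]
    nlinarith [(n i₀).cast_nonneg (α := ℝ)]
  rw [hX.transition_one_div hα]
  refine mul_le_mul_of_nonneg_right (sub_le_sub_left ?_ 1) (by positivity)
  calc c * (α / (α + 1)) / (∑ i, v i * n i + b)
      ≤ c * ((α + n i₀) / (α + n i₀ + 1)) / (∑ i, v i * n i + b) := by gcongr
    _ = c * (α + n i₀) / (∑ i, v i * n i + b) / (α + n i₀ + 1) := by ring
    _ ≤ X.rate n i₀ / (α + n i₀ + 1) := by gcongr; exact h_rate n

/-- The weight in the urn of the colours other than `i₀`, with `b` extra balls of each colour and an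
extra weight `b`. -/
def rivalWeight (v : ι → ℝ) (i₀ : ι) (b : ℝ) (n : ι → ℕ) : ℝ :=
  ∑ i ∈ Finset.univ.erase i₀, v i * (b + n i) + b

theorem rivalWeight_pos (hv : ∀ i, 0 ≤ v i) (hb : 0 < b) (n : ι → ℕ) :
    0 < rivalWeight v i₀ b n :=
  add_pos_of_nonneg_of_pos (Finset.sum_nonneg fun i _ => mul_nonneg (hv i) (by positivity)) hb

theorem rivalWeight_add_single_self (n : ι → ℕ) :
    rivalWeight v i₀ b (n + Pi.single i₀ 1) = rivalWeight v i₀ b n := by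
  simp only [rivalWeight, mul_add, Finset.sum_add_distrib, sum_mul_add_single,
    Finset.notMem_erase, if_false, add_zero]

theorem rivalWeight_add_single_of_ne {i : ι} (hi : i ≠ i₀) (n : ι → ℕ) :
    rivalWeight v i₀ b (n + Pi.single i 1) = rivalWeight v i₀ b n + v i := by
  simp only [rivalWeight, mul_add, Finset.sum_add_distrib, sum_mul_add_single,
    Finset.mem_erase_of_ne_of_mem hi (Finset.mem_univ i), if_true]
  ring

/-- The shift by `-1` makes the term of the colour `i₀` a multiple of `(α + n i₀)⁻¹`, which cancels
against the lower bound for its jump probability. -/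
theorem IsUrn.transition_rivalWeight_div (hX : X.IsUrn) (hα : 0 < α) {n : ι → ℕ}
    (hn : 1 ≤ n i₀) :
    X.transition (fun n => rivalWeight v i₀ b n / (α + n i₀ - 1)) n =
      rivalWeight v i₀ b n / (α + n i₀ - 1) +
        (∑ i ∈ Finset.univ.erase i₀, v i * X.rate n i) / (α + n i₀ - 1) -
          X.rate n i₀ / (α + n i₀) * (rivalWeight v i₀ b n / (α + n i₀ - 1)) := by
  have h_pos : 0 < α + n i₀ - 1 := by
    have : (1 : ℝ) ≤ n i₀ := by exact_mod_cast hn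
    linarith
  have h_self : X.rate n i₀ * (rivalWeight v i₀ b (n + Pi.single i₀ 1) /
      (α + ((n + Pi.single i₀ 1 : ι → ℕ) i₀ : ℝ) - 1) - rivalWeight v i₀ b n / (α + n i₀ - 1)) =
      -(X.rate n i₀ / (α + n i₀) * (rivalWeight v i₀ b n / (α + n i₀ - 1))) := by
    rw [rivalWeight_add_single_self, Pi.add_apply, Pi.single_eq_same]
    push_cast
    rw [← add_assoc, add_sub_cancel_right]
    field_simp
    ring
  have h_rival : ∀ i ∈ Finset.univ.erase i₀, X.rate n i *
      (rivalWeight v i₀ b (n + Pi.single i 1) / (α + ((n + Pi.single i 1 : ι → ℕ) i₀ : ℝ) - 1) -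
        rivalWeight v i₀ b n / (α + n i₀ - 1)) = v i * X.rate n i / (α + n i₀ - 1) := by
    intro i hi
    have hi₀ := Finset.ne_of_mem_erase hi
    rw [rivalWeight_add_single_of_ne hi₀, Pi.add_apply, Pi.single_eq_of_ne hi₀.symm, add_zero]
    ring
  rw [transition_apply, ← Finset.add_sum_erase _ _ (Finset.mem_univ i₀)]
  simp only [hX n]
  rw [h_self, Finset.sum_congr rfl h_rival, ← Finset.sum_div]
  ring

theorem sum_erase_mul_rate_mul_le (hv : ∀ i, 0 ≤ v i) (hb : 0 < b) (hc' : 0 ≤ c') {n : ι → ℕ}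
    (h_rival : ∀ i ≠ i₀, X.rate n i * ∑ j, v j * n j ≤ c' * (b + n i)) :
    (∑ i ∈ Finset.univ.erase i₀, v i * X.rate n i) * ∑ j, v j * n j ≤
      c' * rivalWeight v i₀ b n := by
  calc (∑ i ∈ Finset.univ.erase i₀, v i * X.rate n i) * ∑ j, v j * n j
      = ∑ i ∈ Finset.univ.erase i₀, v i * (X.rate n i * ∑ j, v j * n j) := by
        simp only [Finset.sum_mul, mul_assoc]
    _ ≤ ∑ i ∈ Finset.univ.erase i₀, v i * (c' * (b + n i)) :=
        Finset.sum_le_sum fun i hi =>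
          mul_le_mul_of_nonneg_left (h_rival i (Finset.ne_of_mem_erase hi)) (hv i)
    _ = c' * ∑ i ∈ Finset.univ.erase i₀, v i * (b + n i) := by
        rw [Finset.mul_sum]
        exact Finset.sum_congr rfl fun i _ => by ring
    _ ≤ c' * rivalWeight v i₀ b n := by
        rw [rivalWeight]
        gcongr
        linarith

theorem IsUrn.vanishesFrom_rivalWeight_div (hX : X.IsUrn) (hv : ∀ i, 0 ≤ v i) (hv₀ : 0 < v i₀)
    (hα : 0 < α) (hb : 0 < b) (hc' : 0 ≤ c') (hc : c' < c)
    (h_rate : ∀ n, c * (α + n i₀) / (∑ i, v i * n i + b) ≤ X.rate n i₀)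
    (h_rival : ∀ n, ∀ i ≠ i₀, X.rate n i * ∑ j, v j * n j ≤ c' * (b + n i))
    {m : ℕ} (hm₁ : 1 ≤ m) (hm : c' * b ≤ (c - c') / 2 * (v i₀ * m)) {n : ι → ℕ}
    (hn : m ≤ n i₀) : X.VanishesFrom (fun n => rivalWeight v i₀ b n / (α + n i₀ - 1)) n := by
  have h_pos {n : ι → ℕ} (hn : m ≤ n i₀) : 0 < α + n i₀ - 1 := by
    have : (1 : ℝ) ≤ n i₀ := by exact_mod_cast hm₁.trans hn
    linarith
  refine hX.vanishesFrom_of_drift hv hb (hX.isAbsorbing_le i₀ m) (half_pos (sub_pos.2 hc))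
    (fun n hn => (div_pos (rivalWeight_pos hv hb n) (h_pos hn)).le) (fun n hn => ?_) hn
  set W := rivalWeight v i₀ b n
  set S := ∑ i, v i * (n i : ℝ)
  set x := α + n i₀ - 1
  have hx : 0 < x := h_pos hn
  have hW : 0 < W := rivalWeight_pos hv hb n
  have hmS : v i₀ * m ≤ S := by
    refine (mul_le_mul_of_nonneg_left (Nat.cast_le.2 hn) hv₀.le).trans ?_
    exact Finset.single_le_sum (f := fun i => v i * (n i : ℝ))
      (fun i _ => mul_nonneg (hv i) (n i).cast_nonneg) (Finset.mem_univ i₀)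
  have hS_pos : 0 < S := (mul_pos hv₀ (by exact_mod_cast hm₁)).trans_le hmS
  have h_gain : (∑ i ∈ Finset.univ.erase i₀, v i * X.rate n i) / x ≤ c' / S * (W / x) := by
    rw [← mul_div_assoc, div_mul_eq_mul_div]
    gcongr
    exact (le_div_iff₀ hS_pos).2 (sum_erase_mul_rate_mul_le hv hb hc' (h_rival n))
  have h_loss : c / (S + b) * (W / x) ≤ X.rate n i₀ / (α + n i₀) * (W / x) := by
    refine mul_le_mul_of_nonneg_right ?_ (div_pos hW hx).le
    rw [le_div_iff₀ (by positivity), div_mul_eq_mul_div]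
    exact h_rate n
  have h_gap : c' / S ≤ c / (S + b) - (c - c') / 2 / (S + b) := by
    rw [← sub_div, div_le_div_iff₀ hS_pos (by positivity)]
    nlinarith [hm.trans (mul_le_mul_of_nonneg_left hmS (half_pos (sub_pos.2 hc)).le)]
  rw [hX.transition_rivalWeight_div hα (hm₁.trans hn)]
  nlinarith [mul_le_mul_of_nonneg_right h_gap (div_pos hW hx).le]

/-- The count of the colour `i₀` exceeds any threshold with probability tending to one, and beyond a
large threshold the ratio of the rival weight to that count is contracted. -/
theorem IsUrn.vanishesFrom_of_dominant (hX : X.IsUrn) (hv : ∀ i, 0 ≤ v i) (hv₀ : 0 < v i₀)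
    (hα : 0 < α) (hb : 0 < b) (hc' : 0 ≤ c') (hc : c' < c)
    (h_rate : ∀ n, c * (α + n i₀) / (∑ i, v i * n i + b) ≤ X.rate n i₀)
    (h_rival : ∀ n, ∀ i ≠ i₀, X.rate n i * ∑ j, v j * n j ≤ c' * (b + n i))
    {h : (ι → ℕ) → ℝ} (h_nonneg : ∀ n, 0 ≤ h n) (h_le_one : ∀ n, h n ≤ 1)
    (h_le : ∀ n, h n ≤ rivalWeight v i₀ b n / (v i₀ * (α + n i₀))) (n : ι → ℕ) :
    X.VanishesFrom h n := by
  obtain ⟨m, hm, hm₁⟩ : ∃ m : ℕ, c' * b ≤ (c - c') / 2 * (v i₀ * m) ∧ 1 ≤ m := by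
    have h_lim : Tendsto (fun m : ℕ => (c - c') / 2 * (v i₀ * m)) atTop atTop :=
      (tendsto_natCast_atTop_atTop.const_mul_atTop hv₀).const_mul_atTop (half_pos (sub_pos.2 hc))
    exact ((h_lim.eventually_ge_atTop _).and (eventually_ge_atTop 1)).exists
  have h_beyond : ∀ n ∈ {n : ι → ℕ | m ≤ n i₀}, X.VanishesFrom h n := fun n hn => by
    refine (hX.isAbsorbing_le i₀ m).vanishesFrom_of_le (fun n _ => h_nonneg n) (fun n hn => ?_) hn
      ((hX.vanishesFrom_rivalWeight_div hv hv₀ hα hb hc' hc h_rate h_rival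
        hm₁ hm hn).const_mul (1 / v i₀))
    have h_one : (1 : ℝ) ≤ n i₀ := Nat.one_le_cast.2 (hm₁.trans hn)
    have hW := rivalWeight_pos (i₀ := i₀) hv hb n
    rw [div_mul_div_comm, one_mul]
    refine (h_le n).trans (div_le_div_of_nonneg_left hW.le (mul_pos hv₀ (by linarith)) ?_)
    exact mul_le_mul_of_nonneg_left (by linarith) hv₀.le
  have h_below : ∀ n ∉ {n : ι → ℕ | m ≤ n i₀}, 1 ≤ (α + m) * (1 / (α + n i₀)) := fun n hn => by
    have h_lt : (n i₀ : ℝ) ≤ m := Nat.cast_le.2 (not_le.1 hn).le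
    rw [mul_one_div, one_le_div (by positivity)]
    linarith
  have h_reach : X.VanishesFrom (fun n => (α + m) * (1 / (α + n i₀))) n :=
    (hX.vanishesFrom_one_div hv hα hb (hc'.trans_lt hc) h_rate n).const_mul (α + m)
  exact vanishesFrom_of_reached h_nonneg h_le_one h_beyond (fun n => by positivity) h_below h_reach

end Urn

end JumpChain

theorem toReal_pmf_bind_apply {α β : Type*} [Fintype α] (p : PMF α) (f : α → PMF β) (b : β) :
    (p.bind f b).toReal = ∑ a, (p a).toReal * (f a b).toReal := by
  rw [PMF.bind_apply, tsum_fintype, ENNReal.toReal_sum fun a _ =>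
    ENNReal.mul_ne_top (p.apply_ne_top a) ((f a).apply_ne_top b)]
  simp only [ENNReal.toReal_mul]

theorem exists_lt_forall_ne_le {ι : Type*} [Finite ι] {f : ι → ℝ} {i₀ : ι} {c : ℝ} (hc : 0 < c)
    (hf : ∀ i ≠ i₀, f i < c) : ∃ c' < c, 0 ≤ c' ∧ ∀ i ≠ i₀, f i ≤ c' := by
  classical
  have : Nonempty ι := ⟨i₀⟩
  obtain ⟨j, h_max⟩ := Finite.exists_max (Function.update f i₀ 0)
  refine ⟨Function.update f i₀ 0 j, ?_, by simpa using h_max i₀, fun i hi => ?_⟩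
  · rcases eq_or_ne j i₀ with rfl | hj
    · simpa using hc
    · simpa [hj] using hf j hj
  · simpa [hi] using h_max i

theorem classWeight_pos {K : ℕ} {rate : Fin K → ℝ} (h : ∀ k, 0 < rate k) (k : Fin K) :
    0 < classWeight rate k :=
  div_pos (h k) (Finset.sum_pos (fun l _ => h l) ⟨k, Finset.mem_univ k⟩)

theorem recordPurchase_none {N K : ℕ} (D : Fin K → Fin N → ℕ) (k : Fin K) :
    recordPurchase D (k, none) = D := by
  ext
  simp [recordPurchase]

/-- The popularity vector seen by a group `A` of classes that pool their past purchases. -/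
def pooledCounts {N K : ℕ} (A : Finset (Fin K)) (D : Fin K → Fin N → ℕ) : Fin N → ℕ :=
  fun i => ∑ k ∈ A, D k i

theorem pooledCounts_recordPurchase {N K : ℕ} (A : Finset (Fin K)) (D : Fin K → Fin N → ℕ)
    (k : Fin K) (i : Fin N) : pooledCounts A (recordPurchase D (k, some i)) =
      pooledCounts A D + if k ∈ A then Pi.single i 1 else 0 := by
  ext j
  obtain rfl | hj := eq_or_ne i j <;> by_cases hk : k ∈ A <;>
    simp [pooledCounts, recordPurchase, Finset.sum_add_distrib, *]

namespace MMNL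

section Chain

variable {N K : ℕ} (M : MMNL N K)

theorem toReal_buyLaw_bind (k : Fin K) (i : Fin N) {β : Type*} (f : Bool → PMF β) (b : β) :
    ((M.buyLaw k i).bind f b).toReal =
      M.quality i k * (f true b).toReal + (1 - M.quality i k) * (f false b).toReal := by
  rw [toReal_pmf_bind_apply, Fintype.sum_bool]
  simp only [buyLaw, PMF.ofFintype_apply, cond_true, cond_false,
    ENNReal.toReal_ofReal (M.quality_nonneg i k),
    ENNReal.toReal_ofReal (sub_nonneg.2 (M.quality_le_one i k))]

theorem toReal_tryLaw_bind (σ : Equiv.Perm (Fin N)) (d : Fin N → ℕ) (k : Fin K) {β : Type*}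
    (f : Option (Fin N) → PMF β) (b : β) :
    ((M.tryLaw σ d k).bind f b).toReal = (1 - ∑ i, M.tryProb σ d k i) * (f none b).toReal +
      ∑ i, M.tryProb σ d k i * (f (some i) b).toReal := by
  rw [toReal_pmf_bind_apply, Fintype.sum_option]
  simp only [tryLaw, PMF.ofFintype_apply, Option.elim_none, Option.elim_some,
    ENNReal.toReal_ofReal (M.tryProb_nonneg σ d k _),
    ENNReal.toReal_ofReal (sub_nonneg.2 (M.sum_tryProb_le_one σ d k))]

theorem toReal_purchaseLaw_bind (σ : Equiv.Perm (Fin N)) (d : Fin N → ℕ) (k : Fin K)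
    {β : Type*} (f : Option (Fin N) → PMF β) (b : β) :
    ((M.purchaseLaw σ d k).bind f b).toReal = (f none b).toReal +
      ∑ i, M.tryProb σ d k i * M.quality i k * ((f (some i) b).toReal - (f none b).toReal) := by
  rw [purchaseLaw, PMF.bind_bind, toReal_tryLaw_bind]
  simp only [Option.elim_none, Option.elim_some, PMF.pure_bind, PMF.bind_map,
    toReal_buyLaw_bind, Function.comp_apply, if_true, Bool.false_eq_true, if_false]
  rw [sub_mul, one_mul, Finset.sum_mul, sub_add_eq_add_sub, add_sub_assoc,
    ← Finset.sum_sub_distrib]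
  congr 1
  exact Finset.sum_congr rfl fun i _ => by ring

theorem toReal_arrivalLaw (k : Fin K) : (M.arrivalLaw k).toReal = M.weight k := by
  rw [arrivalLaw, PMF.ofFintype_apply, ENNReal.toReal_ofReal (M.weight_nonneg k)]

theorem sum_tryProb_mul_quality_le_one (σ : Equiv.Perm (Fin N)) (d : Fin N → ℕ) (k : Fin K) :
    ∑ i, M.tryProb σ d k i * M.quality i k ≤ 1 :=
  (Finset.sum_le_sum fun i _ =>
    mul_le_of_le_one_right (M.tryProb_nonneg σ d k i) (M.quality_le_one i k)).trans
      (M.sum_tryProb_le_one σ d k)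

/-- The purchase counts of a market as a jump chain: the jump `(k, i)` is the purchase of item `i`
by a consumer of class `k`. -/
noncomputable def chain (τ : Fin K → Equiv.Perm (Fin N))
    (signal : (Fin K → Fin N → ℕ) → Fin K → Fin N → ℕ) :
    JumpChain (Fin K → Fin N → ℕ) (Fin K × Fin N) where
  rate D c := M.weight c.1 * (M.tryProb (τ c.1) (signal D c.1) c.1 c.2 * M.quality c.2 c.1)
  step D c := recordPurchase D (c.1, some c.2)
  rate_nonneg D c := mul_nonneg (M.weight_nonneg _)
    (mul_nonneg (M.tryProb_nonneg _ _ _ _) (M.quality_nonneg _ _))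
  sum_rate_le_one D := by
    rw [Fintype.sum_prod_type, ← M.sum_weight]
    refine Finset.sum_le_sum fun k _ => ?_
    simp only [← Finset.mul_sum]
    exact mul_le_of_le_one_right (M.weight_nonneg k) (M.sum_tryProb_mul_quality_le_one _ _ k)

variable (τ : Fin K → Equiv.Perm (Fin N))
  (signal : (Fin K → Fin N → ℕ) → Fin K → Fin N → ℕ)

theorem toReal_consumerLaw_bind (D : Fin K → Fin N → ℕ) {β : Type*}
    (f : Fin K × Option (Fin N) → PMF β) (b : β) :
    ((M.consumerLaw τ signal D).bind f b).toReal =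
      ∑ k, M.weight k * (f (k, none) b).toReal +
        ∑ c, (M.chain τ signal).rate D c *
          ((f (c.1, some c.2) b).toReal - (f (c.1, none) b).toReal) := by
  rw [consumerLaw, PMF.bind_bind, toReal_pmf_bind_apply, Fintype.sum_prod_type]
  simp only [PMF.bind_map, toReal_purchaseLaw_bind, Function.comp_apply, toReal_arrivalLaw,
    mul_add, Finset.mul_sum, Finset.sum_add_distrib, chain, mul_assoc]

theorem toReal_countsLaw_bind {β : Type*} (b : β) (t : ℕ) (f : (Fin K → Fin N → ℕ) → PMF β) :
    ((M.countsLaw τ signal t).bind f b).toReal =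
      ((M.chain τ signal).transition ^ t) (fun D => (f D b).toReal) 0 := by
  induction t generalizing f with
  | zero => simp [countsLaw]
  | succ t ih =>
    rw [countsLaw, PMF.bind_bind, ih, pow_succ, Module.End.mul_apply]
    refine congrArg (fun g => ((M.chain τ signal).transition ^ t) g 0) (funext fun D => ?_)
    rw [PMF.bind_map, toReal_consumerLaw_bind, JumpChain.transition_apply]
    simp only [Function.comp_apply, recordPurchase_none, ← Finset.sum_mul, M.sum_weight, one_mul]
    rfl

theorem purchaseProb_eq_transition_pow (t : ℕ) :
    M.purchaseProb τ signal t = ((M.chain τ signal).transition ^ t)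
      (fun D => ∑ c, (M.chain τ signal).rate D c) 0 := by
  rw [purchaseProb, ← PMF.bind_pure_comp, PMF.bind_bind, toReal_countsLaw_bind]
  refine congrArg (fun g => ((M.chain τ signal).transition ^ t) g 0) (funext fun D => ?_)
  rw [toReal_consumerLaw_bind]
  simp

theorem abs_sum_tryProb_mul_quality_sub_le (σ : Equiv.Perm (Fin N)) (d : Fin N → ℕ) (k : Fin K)
    (i₀ : Fin N) : |∑ i, M.tryProb σ d k i * M.quality i k - M.quality i₀ k| ≤
      1 - M.tryProb σ d k i₀ := by
  have h_split := Finset.add_sum_erase Finset.univ (M.tryProb σ d k) (Finset.mem_univ i₀)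
  have h_le_one := M.sum_tryProb_le_one σ d k
  have h_rest : ∑ i ∈ Finset.univ.erase i₀, M.tryProb σ d k i * M.quality i k ≤
      ∑ i ∈ Finset.univ.erase i₀, M.tryProb σ d k i := Finset.sum_le_sum fun i _ =>
    mul_le_of_le_one_right (M.tryProb_nonneg σ d k i) (M.quality_le_one i k)
  have h_rest_nonneg : 0 ≤ ∑ i ∈ Finset.univ.erase i₀, M.tryProb σ d k i * M.quality i k :=
    Finset.sum_nonneg fun i _ => mul_nonneg (M.tryProb_nonneg σ d k i) (M.quality_nonneg i k)
  have h_gap : 0 ≤ 1 - M.tryProb σ d k i₀ := by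
    linarith [Finset.sum_nonneg fun i (_ : i ∈ Finset.univ.erase i₀) => M.tryProb_nonneg σ d k i]
  rw [← Finset.add_sum_erase _ _ (Finset.mem_univ i₀), abs_le]
  constructor
  · nlinarith [mul_le_of_le_one_right h_gap (M.quality_le_one i₀ k)]
  · nlinarith [mul_nonneg h_gap (M.quality_nonneg i₀ k)]

variable {τ signal}

theorem tendsto_purchaseProb {i₀ : Fin K → Fin N}
    (h : ∀ k, (M.chain τ signal).VanishesFrom
      (fun D => 1 - M.tryProb (τ k) (signal D k) k (i₀ k)) 0) :
    Tendsto (M.purchaseProb τ signal) atTop (𝓝 (∑ k, M.weight k * M.quality (i₀ k) k)) := by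
  simp only [funext (M.purchaseProb_eq_transition_pow τ signal)]
  refine JumpChain.tendsto_transition_pow_of_abs_sub_le (fun D => ?_)
    (JumpChain.VanishesFrom.finset_sum (u := Finset.univ) fun k _ => (h k).const_mul (M.weight k))
  simp only [chain, Fintype.sum_prod_type, ← Finset.mul_sum, ← Finset.sum_sub_distrib, ← mul_sub]
  refine (Finset.abs_sum_le_sum_abs _ _).trans (Finset.sum_le_sum fun k _ => ?_)
  rw [abs_mul, abs_of_nonneg (M.weight_nonneg k)]
  exact mul_le_mul_of_nonneg_left (M.abs_sum_tryProb_mul_quality_sub_le _ _ k _)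
    (M.weight_nonneg k)

end Chain

section Pooling

variable {N K : ℕ} (M : MMNL N K) (σ : Equiv.Perm (Fin N)) (A : Finset (Fin K))

/-- The mean quality of item `i` for the classes in `A`, times the total weight of `A`. -/
noncomputable def pooledQuality (i : Fin N) : ℝ := ∑ k ∈ A, M.weight k * M.quality i k

/-- The urn formed by the purchases of a group `A` of classes that are all shown the ranking `σ`
and the past purchases of the group. -/
noncomputable def pooledUrn : JumpChain (Fin N → ℕ) (Fin N) where
  rate d i := ∑ k ∈ A, M.weight k * (M.tryProb σ d k i * M.quality i k)
  step d i := d + Pi.single i 1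
  rate_nonneg d i := Finset.sum_nonneg fun k _ => mul_nonneg (M.weight_nonneg k)
    (mul_nonneg (M.tryProb_nonneg σ d k i) (M.quality_nonneg i k))
  sum_rate_le_one d := by
    rw [Finset.sum_comm, ← M.sum_weight]
    refine (Finset.sum_le_sum fun k _ => ?_).trans
      (Finset.sum_le_univ_sum_of_nonneg M.weight_nonneg)
    rw [← Finset.mul_sum]
    exact mul_le_of_le_one_right (M.weight_nonneg k) (M.sum_tryProb_mul_quality_le_one σ d k)

theorem isUrn_pooledUrn : (M.pooledUrn σ A).IsUrn := fun _ _ => rfl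

variable {M σ A}

theorem transition_chain_comp_pooledCounts {τ : Fin K → Equiv.Perm (Fin N)}
    {signal : (Fin K → Fin N → ℕ) → Fin K → Fin N → ℕ} (hτ : ∀ k ∈ A, τ k = σ)
    (h_signal : ∀ D, ∀ k ∈ A, signal D k = pooledCounts A D) (f : (Fin N → ℕ) → ℝ) :
    (M.chain τ signal).transition (f ∘ pooledCounts A) =
      (M.pooledUrn σ A).transition f ∘ pooledCounts A := by
  funext D
  simp only [JumpChain.transition_apply, Function.comp_apply, chain, pooledUrn,
    pooledCounts_recordPurchase, Fintype.sum_prod_type, Finset.sum_mul]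
  rw [Finset.sum_comm (s := Finset.univ) (t := A), add_right_inj, ← Finset.sum_subset A.subset_univ]
  · refine Finset.sum_congr rfl fun k hk => Finset.sum_congr rfl fun i _ => ?_
    rw [hτ k hk, h_signal D k hk, if_pos hk]
  · intro k _ hk
    simp [hk]

section Bounds

variable {α b : ℝ} {k : Fin K}

theorem exists_appeal_bounds (M : MMNL N K) (σ : Equiv.Perm (Fin N)) :
    ∃ α b : ℝ, 0 < α ∧ 0 < b ∧ (∀ i k, α ≤ M.appeal i k) ∧ (∀ i k, M.appeal i k ≤ b) ∧
      ∀ k, ∑ j, M.vis (σ j) * M.appeal j k + M.z ≤ b := by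
  obtain ⟨j, -⟩ := M.exists_vis_pos
  have : Nonempty (Fin N × Fin K) := ⟨j, 0, M.classes_pos⟩
  obtain ⟨p, h_min⟩ := Finite.exists_min fun p : Fin N × Fin K => M.appeal p.1 p.2
  obtain ⟨b₁, h₁⟩ := Finite.exists_le fun p : Fin N × Fin K => M.appeal p.1 p.2
  obtain ⟨b₂, h₂⟩ := Finite.exists_le fun k => ∑ j, M.vis (σ j) * M.appeal j k + M.z
  exact ⟨M.appeal p.1 p.2, max b₁ b₂, M.appeal_pos _ _,
    (M.appeal_pos _ _).trans_le ((h₁ p).trans (le_max_left _ _)), fun i k => h_min (i, k),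
    fun i k => (h₁ (i, k)).trans (le_max_left _ _), fun k => (h₂ k).trans (le_max_right _ _)⟩

theorem sum_vis_mul_add_z_pos (d : Fin N → ℕ) (k : Fin K) :
    0 < ∑ j, M.vis (σ j) * (M.appeal j k + d j) + M.z := by
  obtain ⟨p, hp⟩ := M.exists_vis_pos
  refine add_pos_of_pos_of_nonneg (Finset.sum_pos' (fun j _ => M.vis_mul_nonneg σ d k j)
    ⟨σ.symm p, Finset.mem_univ _, ?_⟩) M.z_nonneg
  rw [σ.apply_symm_apply]
  exact mul_pos hp (add_pos_of_pos_of_nonneg (M.appeal_pos _ k) (Nat.cast_nonneg _))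

theorem tryProb_mul_sum_vis_mul_le (hb : ∀ i, M.appeal i k ≤ b) (d : Fin N → ℕ) (i : Fin N) :
    M.tryProb σ d k i * ∑ j, M.vis (σ j) * d j ≤ M.vis (σ i) * (b + d i) := by
  have h_le : ∑ j, M.vis (σ j) * (d j : ℝ) ≤
      ∑ j, M.vis (σ j) * (M.appeal j k + d j) + M.z :=
    (Finset.sum_le_sum fun j _ => mul_le_mul_of_nonneg_left
      (le_add_of_nonneg_left (M.appeal_pos j k).le) (M.vis_nonneg _)).trans
        (le_add_of_nonneg_right M.z_nonneg)
  calc M.tryProb σ d k i * ∑ j, M.vis (σ j) * d j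
      ≤ M.tryProb σ d k i * (∑ j, M.vis (σ j) * (M.appeal j k + d j) + M.z) :=
        mul_le_mul_of_nonneg_left h_le (M.tryProb_nonneg σ d k i)
    _ = M.vis (σ i) * (M.appeal i k + d i) := div_mul_cancel₀ _ (sum_vis_mul_add_z_pos d k).ne'
    _ ≤ M.vis (σ i) * (b + d i) :=
        mul_le_mul_of_nonneg_left (by linarith [hb i]) (M.vis_nonneg _)

theorem div_le_tryProb (hα : ∀ i, α ≤ M.appeal i k)
    (hb : ∑ j, M.vis (σ j) * M.appeal j k + M.z ≤ b) (d : Fin N → ℕ) (i : Fin N) :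
    M.vis (σ i) * (α + d i) / (∑ j, M.vis (σ j) * d j + b) ≤ M.tryProb σ d k i := by
  refine div_le_div₀ (M.vis_mul_nonneg σ d k i)
    (mul_le_mul_of_nonneg_left (by linarith [hα i]) (M.vis_nonneg _))
    (sum_vis_mul_add_z_pos d k) ?_
  simp only [mul_add, Finset.sum_add_distrib]
  linarith

theorem one_sub_tryProb_le (hα₀ : 0 < α) (hα : ∀ i, α ≤ M.appeal i k)
    (hb : ∀ i, M.appeal i k ≤ b) (hbz : ∑ j, M.vis (σ j) * M.appeal j k + M.z ≤ b) {i₀ : Fin N}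
    (h_vis : 0 < M.vis (σ i₀)) (d : Fin N → ℕ) :
    1 - M.tryProb σ d k i₀ ≤
      JumpChain.rivalWeight (fun i => M.vis (σ i)) i₀ b d / (M.vis (σ i₀) * (α + d i₀)) := by
  have h_den := sum_vis_mul_add_z_pos (M := M) (σ := σ) d k
  have h_split := Finset.add_sum_erase Finset.univ
    (fun j => M.vis (σ j) * (M.appeal j k + d j)) (Finset.mem_univ i₀)
  have h_rest : 0 ≤ ∑ j ∈ Finset.univ.erase i₀, M.vis (σ j) * (M.appeal j k + d j) :=
    Finset.sum_nonneg fun j _ => M.vis_mul_nonneg σ d k j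
  have h_z : M.z ≤ b := (le_add_of_nonneg_left (Finset.sum_nonneg fun j _ =>
    mul_nonneg (M.vis_nonneg _) (M.appeal_pos j k).le)).trans hbz
  have h_rival : ∑ j ∈ Finset.univ.erase i₀, M.vis (σ j) * (M.appeal j k + d j) + M.z ≤
      JumpChain.rivalWeight (fun i => M.vis (σ i)) i₀ b d :=
    add_le_add (Finset.sum_le_sum fun j _ =>
      mul_le_mul_of_nonneg_left (by linarith [hb j]) (M.vis_nonneg _)) h_z
  rw [tryProb, one_sub_div h_den.ne']
  refine div_le_div₀ ((add_nonneg h_rest M.z_nonneg).trans h_rival) (by linarith)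
    (by positivity) ?_
  have h_appeal : M.vis (σ i₀) * (α + d i₀) ≤ M.vis (σ i₀) * (M.appeal i₀ k + d i₀) :=
    mul_le_mul_of_nonneg_left (by linarith [hα i₀]) h_vis.le
  linarith [M.z_nonneg]

theorem pooledUrn_rate_mul_sum_vis_mul_le (hb : ∀ i k, M.appeal i k ≤ b) (d : Fin N → ℕ)
    (i : Fin N) : (M.pooledUrn σ A).rate d i * ∑ j, M.vis (σ j) * d j ≤
      M.pooledQuality A i * M.vis (σ i) * (b + d i) := by
  simp only [pooledUrn, pooledQuality, Finset.sum_mul]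
  refine Finset.sum_le_sum fun k _ => ?_
  linarith [mul_le_mul_of_nonneg_left (tryProb_mul_sum_vis_mul_le (σ := σ) (fun i => hb i k) d i)
    (mul_nonneg (M.weight_nonneg k) (M.quality_nonneg i k))]

theorem div_le_pooledUrn_rate (hα : ∀ i k, α ≤ M.appeal i k)
    (hb : ∀ k, ∑ j, M.vis (σ j) * M.appeal j k + M.z ≤ b) (d : Fin N → ℕ) (i : Fin N) :
    M.pooledQuality A i * M.vis (σ i) * (α + d i) / (∑ j, M.vis (σ j) * d j + b) ≤
      (M.pooledUrn σ A).rate d i := by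
  simp only [pooledUrn, pooledQuality, Finset.sum_mul, Finset.sum_div]
  refine Finset.sum_le_sum fun k _ => ?_
  have h_le := mul_le_mul_of_nonneg_left (div_le_tryProb (fun i => hα i k) (hb k) d i)
    (mul_nonneg (M.weight_nonneg k) (M.quality_nonneg i k))
  calc _ = M.weight k * M.quality i k *
        (M.vis (σ i) * (α + d i) / (∑ j, M.vis (σ j) * d j + b)) := by ring
    _ ≤ _ := h_le
    _ = _ := by ring

end Bounds

theorem pooledUrn_vanishesFrom_one_sub_tryProb {i₀ : Fin N}
    (h_pos : 0 < M.pooledQuality A i₀ * M.vis (σ i₀))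
    (h_dom : ∀ i ≠ i₀,
      M.pooledQuality A i * M.vis (σ i) < M.pooledQuality A i₀ * M.vis (σ i₀))
    (k : Fin K) (d : Fin N → ℕ) :
    (M.pooledUrn σ A).VanishesFrom (fun d => 1 - M.tryProb σ d k i₀) d := by
  obtain ⟨α, b, hα₀, hb₀, hα, hb, hbz⟩ := M.exists_appeal_bounds σ
  obtain ⟨c', hc', hc'₀, h_le⟩ := exists_lt_forall_ne_le h_pos h_dom
  have h_vis : 0 < M.vis (σ i₀) :=
    (M.vis_nonneg _).lt_of_ne fun h => h_pos.ne (by rw [← h, mul_zero])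
  refine (M.isUrn_pooledUrn σ A).vanishesFrom_of_dominant (fun i => M.vis_nonneg (σ i)) h_vis
    hα₀ hb₀ hc'₀ hc' (fun d => div_le_pooledUrn_rate hα hbz d i₀) (fun d i hi => ?_)
    (fun d => ?_) (fun d => sub_le_self _ (M.tryProb_nonneg σ d k i₀))
    (one_sub_tryProb_le hα₀ (fun i => hα i k) (fun i => hb i k) (hbz k) h_vis) d
  · exact (pooledUrn_rate_mul_sum_vis_mul_le hb d i).trans
      (mul_le_mul_of_nonneg_right (h_le i hi) (by positivity))
  · exact (abs_nonneg _).trans (M.abs_sum_tryProb_mul_quality_sub_le σ d k i₀)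

theorem chain_vanishesFrom_one_sub_tryProb {τ : Fin K → Equiv.Perm (Fin N)}
    {signal : (Fin K → Fin N → ℕ) → Fin K → Fin N → ℕ} (hτ : ∀ k ∈ A, τ k = σ)
    (h_signal : ∀ D, ∀ k ∈ A, signal D k = pooledCounts A D) {i₀ : Fin N}
    (h_pos : 0 < M.pooledQuality A i₀ * M.vis (σ i₀))
    (h_dom : ∀ i ≠ i₀,
      M.pooledQuality A i * M.vis (σ i) < M.pooledQuality A i₀ * M.vis (σ i₀))
    {k : Fin K} (hk : k ∈ A) (D : Fin K → Fin N → ℕ) :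
    (M.chain τ signal).VanishesFrom (fun D => 1 - M.tryProb (τ k) (signal D k) k i₀) D := by
  have h_comp : (fun D => 1 - M.tryProb (τ k) (signal D k) k i₀) =
      (fun d => 1 - M.tryProb σ d k i₀) ∘ pooledCounts A := by
    funext D
    rw [hτ k hk, h_signal D k hk, Function.comp_apply]
  rw [JumpChain.VanishesFrom, h_comp]
  simp only [JumpChain.transition_pow_comp (transition_chain_comp_pooledCounts hτ h_signal)]
  exact pooledUrn_vanishesFrom_one_sub_tryProb h_pos h_dom k _

theorem tendsto_probAQGSI {i₀ : Fin N} (h_pos : 0 < M.avgQuality i₀ * M.vis (σ i₀))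
    (h_dom : ∀ i ≠ i₀, M.avgQuality i * M.vis (σ i) < M.avgQuality i₀ * M.vis (σ i₀)) :
    Tendsto (M.probAQGSI σ) atTop (𝓝 (M.avgQuality i₀)) :=
  M.tendsto_purchaseProb fun k => chain_vanishesFrom_one_sub_tryProb (A := Finset.univ)
    (fun _ _ => rfl) (fun _ _ _ => rfl) h_pos h_dom (Finset.mem_univ k) 0

theorem weight_pos (M : MMNL N K) (k : Fin K) : 0 < M.weight k := classWeight_pos M.rate_pos k

theorem tendsto_probSQSSI {τ : Fin K → Equiv.Perm (Fin N)} {i₀ : Fin K → Fin N}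
    (h_pos : ∀ k, 0 < M.quality (i₀ k) k * M.vis (τ k (i₀ k)))
    (h_dom : ∀ k, ∀ i ≠ i₀ k,
      M.quality i k * M.vis (τ k i) < M.quality (i₀ k) k * M.vis (τ k (i₀ k))) :
    Tendsto (M.probSQSSI τ) atTop (𝓝 (∑ k, M.weight k * M.quality (i₀ k) k)) := by
  refine M.tendsto_purchaseProb fun k => chain_vanishesFrom_one_sub_tryProb (A := {k})
    (σ := τ k) (fun l hl => ?_) (fun D l hl => ?_) ?_ (fun i hi => ?_)
    (Finset.mem_singleton_self k) 0
  · rw [Finset.mem_singleton.1 hl]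
  · rw [Finset.mem_singleton.1 hl]
    funext i
    simp [pooledCounts, classSignal]
  · simpa [pooledQuality, mul_assoc] using mul_pos (M.weight_pos k) (h_pos k)
  · simpa [pooledQuality, mul_assoc] using mul_lt_mul_of_pos_left (h_dom k i hi) (M.weight_pos k)

end Pooling

section Ranking

variable {N K : ℕ} {M : MMNL N K} {σ : Equiv.Perm (Fin N)} {i₀ : Fin N}

theorem vis_le_vis_of_first (h_first : ∀ i ≠ i₀, σ i₀ < σ i) (p : Fin N) :
    M.vis p ≤ M.vis (σ i₀) := by
  refine M.vis_antitone ?_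
  obtain ⟨i, rfl⟩ := σ.surjective p
  rcases eq_or_ne i i₀ with rfl | hi
  · exact le_rfl
  · exact (h_first i hi).le

theorem vis_pos_of_first (h_first : ∀ i ≠ i₀, σ i₀ < σ i) : 0 < M.vis (σ i₀) := by
  obtain ⟨p, hp⟩ := M.exists_vis_pos
  exact hp.trans_le (vis_le_vis_of_first h_first p)

theorem mul_vis_lt_of_first {f : Fin N → ℝ} (h_first : ∀ i ≠ i₀, σ i₀ < σ i)
    (hf : ∀ i, 0 ≤ f i) (h_max : ∀ i ≠ i₀, f i < f i₀) :
    ∀ i ≠ i₀, f i * M.vis (σ i) < f i₀ * M.vis (σ i₀) := fun i hi =>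
  (mul_le_mul_of_nonneg_left (vis_le_vis_of_first h_first _) (hf i)).trans_lt
    (mul_lt_mul_of_pos_right (h_max i hi) (vis_pos_of_first h_first))

theorem exists_perm_sorting (f : Fin N → ℝ) :
    ∃ σ : Equiv.Perm (Fin N), ∀ i j, f j < f i → σ i < σ j := by
  refine ⟨(Tuple.sort fun i => -f i).symm, fun i j h_lt => not_le.1 fun h_le => ?_⟩
  have h_sorted := Tuple.monotone_sort (fun i => -f i) h_le
  simp only [Function.comp_apply, Equiv.apply_symm_apply] at h_sorted
  linarith

theorem exists_isAvgQualityRanking (M : MMNL N K) :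
    ∃ σ : Equiv.Perm (Fin N), M.IsAvgQualityRanking σ :=
  exists_perm_sorting M.avgQuality

theorem exists_isSegQualityRanking (M : MMNL N K) :
    ∃ τ : Fin K → Equiv.Perm (Fin N), M.IsSegQualityRanking τ :=
  Classical.skolem.1 fun k => exists_perm_sorting fun i => M.quality i k

end Ranking

section Extremal

variable {K : ℕ} {M : MMNL K K} {k₀ : Fin K} {ε : ℝ}

/-- `M` is the extremal market with parameter `ε`: class `k` only buys item `k`, and all items have
nearly the same average quality, that of item `k₀` being the largest by a margin of order `ε`. -/
structure IsExtremal (M : MMNL K K) (k₀ : Fin K) (ε : ℝ) : Prop where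
  weight_le : ∀ k, M.weight k₀ ≤ M.weight k
  eps_pos : 0 < ε
  eps_lt : ∀ k ≠ k₀, ε < (⨅ j, M.weight j) / M.weight k
  quality_eq : M.quality = diagQuality M.weight k₀ ε

theorem exists_isExtremal {rate : Fin K → ℝ} {appeal : Fin K → Fin K → ℝ} {vis : Fin K → ℝ} {z : ℝ}
    (h_rate : ∀ k, 0 < rate k) (h_min : ∀ k, classWeight rate k₀ ≤ classWeight rate k)
    (h_appeal : ∀ i k, 0 < appeal i k) (h_vis : ∀ j, 0 ≤ vis j) (h_anti : Antitone vis)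
    (h_vis_pos : ∃ j, 0 < vis j) (hz : 0 ≤ z) (hε : 0 < ε)
    (hε_lt : ∀ k ≠ k₀, ε < (⨅ j, classWeight rate j) / classWeight rate k) :
    ∃ M : MMNL K K, M.rate = rate ∧ M.appeal = appeal ∧ M.vis = vis ∧ M.z = z ∧
      M.IsExtremal k₀ ε := by
  have : Nonempty (Fin K) := ⟨k₀⟩
  have hw := classWeight_pos h_rate
  have h_ratio_le (k : Fin K) : (⨅ j, classWeight rate j) / classWeight rate k ≤ 1 :=
    (div_le_one (hw k)).2 (ciInf_le (Set.finite_range _).bddBelow k)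
  have h_quality (i k : Fin K) : diagQuality (classWeight rate) k₀ ε i k ∈ Set.Icc 0 1 := by
    rw [diagQuality]
    split_ifs with hik hk
    · exact ⟨div_nonneg (Real.iInf_nonneg fun j => (hw j).le) (hw k₀).le, h_ratio_le k₀⟩
    · exact ⟨(sub_pos.2 (hε_lt k hk)).le, (sub_le_self _ hε.le).trans (h_ratio_le k)⟩
    · exact ⟨le_rfl, zero_le_one⟩
  exact ⟨⟨rate, appeal, diagQuality (classWeight rate) k₀ ε, vis, z, k₀.pos, h_rate, h_appeal,
    fun i k => (h_quality i k).1, fun i k => (h_quality i k).2, h_vis, h_anti, h_vis_pos, hz⟩,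
    rfl, rfl, rfl, rfl, h_min, hε, hε_lt, rfl⟩

namespace IsExtremal

theorem iInf_weight (h : M.IsExtremal k₀ ε) : ⨅ j, M.weight j = M.weight k₀ :=
  have : Nonempty (Fin K) := ⟨k₀⟩
  le_antisymm (ciInf_le (Set.finite_range _).bddBelow k₀) (le_ciInf h.weight_le)

theorem quality_of_ne (h : M.IsExtremal k₀ ε) {i k : Fin K} (hik : i ≠ k) :
    M.quality i k = 0 := by
  rw [h.quality_eq, diagQuality, if_neg hik]

theorem quality_self_pos (h : M.IsExtremal k₀ ε) (k : Fin K) : 0 < M.quality k k := by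
  rw [h.quality_eq, diagQuality, if_pos rfl]
  split_ifs with hk
  · rw [h.iInf_weight]
    exact div_pos (M.weight_pos k₀) (M.weight_pos k₀)
  · exact sub_pos.2 (h.eps_lt k hk)

theorem quality_lt (h : M.IsExtremal k₀ ε) {i k : Fin K} (hik : i ≠ k) :
    M.quality i k < M.quality k k := by
  rw [h.quality_of_ne hik]
  exact h.quality_self_pos k

theorem avgQuality_eq_weight_mul (h : M.IsExtremal k₀ ε) (i : Fin K) :
    M.avgQuality i = M.weight i * M.quality i i :=
  Finset.sum_eq_single i (fun k _ hk => by rw [h.quality_of_ne hk.symm, mul_zero]) (by simp)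

theorem avgQuality_eq (h : M.IsExtremal k₀ ε) (i : Fin K) :
    M.avgQuality i = M.weight k₀ - if i = k₀ then 0 else M.weight i * ε := by
  have hw := (M.weight_pos i).ne'
  rw [h.avgQuality_eq_weight_mul, h.quality_eq, diagQuality, if_pos rfl, h.iInf_weight]
  split_ifs with hi
  · rw [hi, mul_div_cancel₀ _ (M.weight_pos k₀).ne', sub_zero]
  · rw [mul_sub, mul_div_cancel₀ _ hw]

theorem avgQuality_self (h : M.IsExtremal k₀ ε) : M.avgQuality k₀ = M.weight k₀ := by
  rw [h.avgQuality_eq, if_pos rfl, sub_zero]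

theorem avgQuality_lt (h : M.IsExtremal k₀ ε) : ∀ i ≠ k₀, M.avgQuality i < M.avgQuality k₀ := by
  intro i hi
  rw [h.avgQuality_self, h.avgQuality_eq, if_neg hi]
  exact sub_lt_self _ (mul_pos (M.weight_pos i) h.eps_pos)

theorem sum_weight_mul_quality (h : M.IsExtremal k₀ ε) :
    ∑ k, M.weight k * M.quality k k = K * M.weight k₀ - (1 - M.weight k₀) * ε := by
  have h_deficit : ∑ k, (if k = k₀ then 0 else M.weight k * ε) = (1 - M.weight k₀) * ε := by
    rw [← Finset.add_sum_erase _ _ (Finset.mem_univ k₀), if_pos rfl, zero_add, ← M.sum_weight,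
      ← Finset.sum_erase_eq_sub (Finset.mem_univ k₀), Finset.sum_mul]
    exact Finset.sum_congr rfl fun k hk => if_neg (Finset.ne_of_mem_erase hk)
  simp only [← h.avgQuality_eq_weight_mul, h.avgQuality_eq]
  rw [Finset.sum_sub_distrib, h_deficit, Finset.sum_const, Finset.card_fin, nsmul_eq_mul]

theorem first_of_isAvgQualityRanking (h : M.IsExtremal k₀ ε) {σ : Equiv.Perm (Fin K)}
    (hσ : M.IsAvgQualityRanking σ) : ∀ i ≠ k₀, σ k₀ < σ i :=
  fun i hi => hσ k₀ i (h.avgQuality_lt i hi)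

theorem avgQuality_mul_vis_lt (h : M.IsExtremal k₀ ε) {σ : Equiv.Perm (Fin K)}
    (hσ : M.IsAvgQualityRanking σ) :
    ∀ i ≠ k₀, M.avgQuality i * M.vis (σ i) < M.avgQuality k₀ * M.vis (σ k₀) :=
  mul_vis_lt_of_first (h.first_of_isAvgQualityRanking hσ)
    (fun i => Finset.sum_nonneg fun k _ => mul_nonneg (M.weight_nonneg k) (M.quality_nonneg i k))
    h.avgQuality_lt

theorem tieBreaking (h : M.IsExtremal k₀ ε) {σ : Equiv.Perm (Fin K)}
    (hσ : M.IsAvgQualityRanking σ) : M.TieBreaking σ :=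
  ⟨k₀, h.avgQuality_mul_vis_lt hσ⟩

theorem segTieBreaking (h : M.IsExtremal k₀ ε) : M.SegTieBreaking :=
  fun k => ⟨k, fun _ hj => h.quality_lt hj⟩

theorem tendsto_probAQGSI (h : M.IsExtremal k₀ ε) {σ : Equiv.Perm (Fin K)}
    (hσ : M.IsAvgQualityRanking σ) : Tendsto (M.probAQGSI σ) atTop (𝓝 (M.weight k₀)) := by
  have h_vis := vis_pos_of_first (M := M) (h.first_of_isAvgQualityRanking hσ)
  rw [← h.avgQuality_self]
  refine MMNL.tendsto_probAQGSI (mul_pos ?_ h_vis) (h.avgQuality_mul_vis_lt hσ)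
  rw [h.avgQuality_self]
  exact M.weight_pos k₀

theorem tendsto_probSQSSI (h : M.IsExtremal k₀ ε) {τ : Fin K → Equiv.Perm (Fin K)}
    (hτ : M.IsSegQualityRanking τ) :
    Tendsto (M.probSQSSI τ) atTop (𝓝 (K * M.weight k₀ - (1 - M.weight k₀) * ε)) := by
  have h_first (k : Fin K) : ∀ i ≠ k, τ k k < τ k i := fun i hi => hτ k k i (h.quality_lt hi)
  rw [← h.sum_weight_mul_quality]
  exact MMNL.tendsto_probSQSSI
    (fun k => mul_pos (h.quality_self_pos k) (vis_pos_of_first (h_first k)))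
    fun k => mul_vis_lt_of_first (h_first k) (fun i => M.quality_nonneg i k)
      fun i hi => h.quality_lt hi

theorem tendsto_ratio (h : M.IsExtremal k₀ ε) {σ : Equiv.Perm (Fin K)}
    {τ : Fin K → Equiv.Perm (Fin K)} (hσ : M.IsAvgQualityRanking σ)
    (hτ : M.IsSegQualityRanking τ) :
    Tendsto (fun t => M.probSQSSI τ t / M.probAQGSI σ t) atTop
      (𝓝 ((K * M.weight k₀ - (1 - M.weight k₀) * ε) / M.weight k₀)) :=
  (h.tendsto_probSQSSI hτ).div (h.tendsto_probAQGSI hσ) (M.weight_pos k₀).ne'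

theorem ratio_le (h : M.IsExtremal k₀ ε) :
    (K * M.weight k₀ - (1 - M.weight k₀) * ε) / M.weight k₀ ≤ K := by
  have h_le_one : M.weight k₀ ≤ 1 := by
    rw [← M.sum_weight]
    exact Finset.single_le_sum (fun l _ => M.weight_nonneg l) (Finset.mem_univ k₀)
  rw [div_le_iff₀ (M.weight_pos k₀)]
  exact sub_le_self _ (mul_nonneg (sub_nonneg.2 h_le_one) h.eps_pos.le)

end IsExtremal

theorem tendsto_extremal_ratio {w : ℝ} (hw : w ≠ 0) (K : ℝ) :
    Tendsto (fun ε => (K * w - (1 - w) * ε) / w) (𝓝[>] 0) (𝓝 K) := by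
  have h_cont : Continuous fun ε : ℝ => (K * w - (1 - w) * ε) / w := by fun_prop
  simpa [hw] using (h_cont.tendsto 0).mono_left nhdsWithin_le_nhds

theorem exists_isExtremal_lt_ratio (hK : 0 < K) {C : ℝ} (hC : C < K) :
    ∃ (M : MMNL K K) (k₀ : Fin K) (ε : ℝ), M.IsExtremal k₀ ε ∧
      C < (K * M.weight k₀ - (1 - M.weight k₀) * ε) / M.weight k₀ := by
  have : Nonempty (Fin K) := ⟨⟨0, hK⟩⟩
  have hw (k : Fin K) : classWeight (fun _ : Fin K => (1 : ℝ)) k = 1 / K := by simp [classWeight]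
  have hw₀ : (1 / K : ℝ) ≠ 0 := by positivity
  obtain ⟨ε, hε_ratio, hε, hε_one⟩ :=
    (((tendsto_extremal_ratio hw₀ K).eventually_const_lt hC).and (Ioo_mem_nhdsGT one_pos)).exists
  obtain ⟨M, h_rate, -, -, -, hM⟩ := exists_isExtremal (k₀ := ⟨0, hK⟩) (rate := fun _ => 1)
    (appeal := fun _ _ => 1) (vis := fun _ => 1) (fun _ => one_pos)
    (fun k => by simp only [hw, le_rfl]) (fun _ _ => one_pos) (fun _ => zero_le_one)
    antitone_const ⟨⟨0, hK⟩, one_pos⟩ le_rfl hε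
    (fun k _ => by simpa only [hw, ciInf_const, div_self hw₀] using hε_one)
  refine ⟨M, _, ε, hM, ?_⟩
  rwa [weight, h_rate, hw]

end Extremal

end MMNL

theorem mainTheorem7 (K : ℕ) (hK : 0 < K) :
    (∀ (rate : Fin K → ℝ) (k₀ : Fin K) (appeal : Fin K → Fin K → ℝ) (vis : Fin K → ℝ) (z : ℝ),
      (∀ k, 0 < rate k) → (∀ k, classWeight rate k₀ ≤ classWeight rate k) →
      (∀ i k, 0 < appeal i k) →
      (∀ j, 0 ≤ vis j) → Antitone vis → (∃ j, 0 < vis j) → 0 ≤ z →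
      ∃ PS PA : ℝ → ℝ,
        (∀ ε : ℝ, 0 < ε →
          (∀ k, k ≠ k₀ → ε < (⨅ j, classWeight rate j) / classWeight rate k) →
          ∃ M : MMNL K K,
            M.rate = rate ∧ M.appeal = appeal ∧ M.vis = vis ∧ M.z = z ∧
            M.quality = diagQuality (classWeight rate) k₀ ε ∧
            ∀ (σ : Equiv.Perm (Fin K)) (τ : Fin K → Equiv.Perm (Fin K)),
              M.IsAvgQualityRanking σ → M.IsSegQualityRanking τ →
              M.TieBreaking σ ∧ M.SegTieBreaking ∧
              Tendsto (fun t => M.probSQSSI τ t) atTop (𝓝 (PS ε)) ∧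
              Tendsto (fun t => M.probAQGSI σ t) atTop (𝓝 (PA ε)) ∧
              0 < PA ε ∧
              Tendsto (fun t => M.probSQSSI τ t / M.probAQGSI σ t) atTop
                (𝓝 (PS ε / PA ε))) ∧
        Tendsto (fun ε => PS ε / PA ε) (𝓝[>] 0) (𝓝 (K : ℝ))) ∧
    (∀ C : ℝ, C < K →
      ∃ (M : MMNL K K) (σ : Equiv.Perm (Fin K)) (τ : Fin K → Equiv.Perm (Fin K)) (L : ℝ),
        M.IsAvgQualityRanking σ ∧ M.IsSegQualityRanking τ ∧
        M.TieBreaking σ ∧ M.SegTieBreaking ∧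
        Tendsto (fun t => M.probSQSSI τ t / M.probAQGSI σ t) atTop (𝓝 L) ∧
        C < L ∧ L ≤ K) := by
  refine ⟨fun rate k₀ appeal vis z h_rate h_min h_appeal h_vis h_anti h_vis_pos hz => ?_,
    fun C hC => ?_⟩
  · have h_weight_pos : 0 < classWeight rate k₀ :=
      classWeight_pos h_rate k₀
    refine ⟨fun ε => K * classWeight rate k₀ - (1 - classWeight rate k₀) * ε,
      fun _ => classWeight rate k₀, fun ε hε hε_lt => ?_,
      MMNL.tendsto_extremal_ratio h_weight_pos.ne' K⟩
    obtain ⟨M, rfl, rfl, rfl, rfl, hM⟩ := MMNL.exists_isExtremal h_rate h_min h_appeal h_vis h_anti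
      h_vis_pos hz hε hε_lt
    exact ⟨M, rfl, rfl, rfl, rfl, hM.quality_eq, fun σ τ hσ hτ =>
      ⟨hM.tieBreaking hσ, hM.segTieBreaking, hM.tendsto_probSQSSI hτ, hM.tendsto_probAQGSI hσ,
        h_weight_pos, hM.tendsto_ratio hσ hτ⟩⟩
  · obtain ⟨M, k₀, ε, hM, h_lt⟩ := MMNL.exists_isExtremal_lt_ratio hK hC
    obtain ⟨σ, hσ⟩ := M.exists_isAvgQualityRanking
    obtain ⟨τ, hτ⟩ := M.exists_isSegQualityRanking
    exact ⟨M, σ, τ, _, hσ, hτ, hM.tieBreaking hσ, hM.segTieBreaking, hM.tendsto_ratio hσ hτ, h_lt,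
      hM.ratio_le⟩
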